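/- Let $\mathbb{D}=\{z\in\mathbb{C}:|z|<1\}$, let $\partial=\tfrac12(\partial_x-i\partial_y)$ and $\bar\partial=\tfrac12(\partial_x+i\partial_y)$ be the Wirtinger derivatives, and put $\xi_m(z)=z^m$ for integers $m\ge 0$ and $\xi_m(z)=\bar z^{|m|}$ for integers $m<0$. Let $F(a,b,c;x)=\sum_{k\ge0}\frac{(a)_k(b)_k}{(c)_k}\frac{x^k}{k!}$, where $(a)_k=a(a+1)\cdots(a+k-1)$, denote the Gauss hypergeometric function. **Theorem (cellular decomposition).** Let $n\ge 1$ be an integer and let $u\in C^{2n}(\mathbb{D})$ be a complex-valued polyharmonic function of order $n$, that is, $\partial^n\bar\partial^n u=0$ in $\mathbb{D}$. Then there are complex numbers $k_{m,j}$ ($m\in\mathbb{Z}$, $0\le j\le n-1$) with $$\limsup_{|m|\to\infty}|k_{m,j}|^{1/|m|}\le 1\qquad(0\le j\le n-1)$$ and functions $w_0,\dots,w_{n-1}\in C^\infty(\mathbb{D})$ such that the following hold. 1. For each $0\le j\le n-1$, $$w_j(z)=\sum_{m=-\infty}^{\infty}k_{m,j}\,F\big(-n+1+j,\;|m|-n+1+j,\;|m|+1;\;|z|^2\big)\,\xi_m(z),\qquad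 z\in\mathbb{D},$$ where the series converges absolutely in $C^\infty(\mathbb{D})$, i.e. absolutely with respect to each of the seminorms $f\mapsto\sup_{z\in K}\|D^rf(z)\|$ with $K\subset\mathbb{D}$ compact and $r\ge 0$ an integer ($D^r$ being the $r$-th real Fréchet derivative). 2. Each $w_j$ is $(n-1-j,n-1-j)$-harmonic: with $\alpha=n-1-j$, $$(1-|z|^2)\,\partial\bar\partial w_j+\alpha z\,\partial w_j+\alpha\bar z\,\bar\partial w_j-\alpha^2w_j=0\quad\text{in }\mathbb{D}.$$ 3. For all $z\in\mathbb{D}$, $$u(z)=w_0(z)+(1-|z|^2)\,w_1(z)+\dots+(1-|z|^2)^{n-1}\,w_{n-1}(z).$$ -/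

import Mathlib

open scoped ContDiff ENNReal ComplexConjugate

noncomputable section

/-- The Wirtinger derivative `∂ f = (∂f/∂x - i ∂f/∂y) / 2`. -/
def wirtinger (f : ℂ → ℂ) (z : ℂ) : ℂ :=
  (fderiv ℝ f z 1 - Complex.I * fderiv ℝ f z Complex.I) / 2

/-- The Wirtinger derivative `∂̄ f = (∂f/∂x + i ∂f/∂y) / 2`. -/
def wirtingerBar (f : ℂ → ℂ) (z : ℂ) : ℂ :=
  (fderiv ℝ f z 1 + Complex.I * fderiv ℝ f z Complex.I) / 2

/-- The open unit disc. Functions on the disc are represented by functions on `ℂ`; since the disc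
is open, the values outside it do not enter into any of the notions below. -/
def unitDisc : Set ℂ := Metric.ball 0 1

/-- `u ∈ C^{2n}(𝔻)` is polyharmonic of order `n`: `∂ⁿ ∂̄ⁿ u = 0` in `𝔻`. -/
def IsPolyharmonic (n : ℕ) (u : ℂ → ℂ) : Prop :=
  ContDiffOn ℝ ((2 * n : ℕ) : WithTop ℕ∞) u unitDisc ∧
    ∀ z ∈ unitDisc, (wirtinger^[n] (wirtingerBar^[n] u)) z = 0

/-- The operator `L_{γ₁,γ₂} = (1 - |z|²) ∂∂̄ + γ₁ z ∂ + γ₂ z̄ ∂̄ - γ₁ γ₂`. -/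
def harmonicOp (γ₁ γ₂ : ℂ) (u : ℂ → ℂ) (z : ℂ) : ℂ :=
  (1 - (‖z‖ : ℂ) ^ 2) * wirtinger (wirtingerBar u) z + γ₁ * z * wirtinger u z
    + γ₂ * conj z * wirtingerBar u z - γ₁ * γ₂ * u z

/-- `u ∈ C²(𝔻)` is `(γ₁, γ₂)`-harmonic: `L_{γ₁,γ₂} u = 0` in `𝔻`. -/
def IsGenHarmonic (γ₁ γ₂ : ℂ) (u : ℂ → ℂ) : Prop :=
  ContDiffOn ℝ 2 u unitDisc ∧ ∀ z ∈ unitDisc, harmonicOp γ₁ γ₂ u z = 0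

/-- `ξ_m(z) = z^m` for `m ≥ 0` and `ξ_m(z) = z̄^{|m|}` for `m < 0`. -/
def xi (m : ℤ) (z : ℂ) : ℂ :=
  if 0 ≤ m then z ^ m.natAbs else conj z ^ m.natAbs

/-- The function `z ↦ F(-n+1+j, |m|-n+1+j, |m|+1; |z|²) ξ_m(z)`, with Mathlib's
Gauss hypergeometric function. -/
def cellTerm (n j : ℕ) (m : ℤ) (z : ℂ) : ℂ :=
  ordinaryHypergeometric (-(n : ℂ) + 1 + j) ((m.natAbs : ℂ) - n + 1 + j) ((m.natAbs : ℂ) + 1)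
    ((‖z‖ : ℂ) ^ 2) * xi m z

/-- `limsup_{|m| → ∞} |k_m|^{1/|m|} ≤ 1`, with the upper limit taken in `[0, ∞]`. -/
def RootLimsupLeOne (k : ℤ → ℂ) : Prop :=
  Filter.limsup (fun m : ℤ => ‖k m‖ₑ ^ (1 / (m.natAbs : ℝ))) Filter.cofinite ≤ 1

/-- The seminorms `sup_{z ∈ K} ‖D^r f(z)‖` which define the topology of `C^∞(𝔻)`
as `K` runs through the compact subsets of `𝔻` and `r` through `ℕ`. -/
def smoothSeminorm (K : Set ℂ) (r : ℕ) (f : ℂ → ℂ) : ℝ≥0∞ :=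
  ⨆ z ∈ K, ‖iteratedFDeriv ℝ r f z‖ₑ

/-- The series `∑_m f_m` of smooth functions on `𝔻` converges absolutely in `C^∞(𝔻)`,
with sum the smooth function `w`. -/
def HasSmoothSum (f : ℤ → ℂ → ℂ) (w : ℂ → ℂ) : Prop :=
  (∀ m, ContDiffOn ℝ ∞ (f m) unitDisc) ∧ ContDiffOn ℝ ∞ w unitDisc ∧
    ∀ K ⊆ unitDisc, IsCompact K → ∀ r : ℕ,
      (∑' m, smoothSeminorm K r (f m)) < ⊤ ∧
      Filter.Tendsto (fun s : Finset ℤ => smoothSeminorm K r (fun z => (∑ m ∈ s, f m z) - w z))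
        Filter.atTop (nhds 0)

end

/-! ### Wirtinger derivatives and polyharmonic functions -/

/-! Integrating `∂ⁿ∂̄ⁿu = 0` first in `z`, then in `z̄`, writes `u` as a finite sum of terms `z^k
G_k(z̄)` and `f_k(z) z̄^k` with `k < n` and `G_k`, `f_k` holomorphic (`IsPolyharmonic.exists_eq`).
Taylor expansion and grouping by angular frequency give `u(z) = ∑ Q_m(|z|²) ξ_m(z)`, where each
`Q_m` has degree less than `n` and its coefficients grow subexponentially in `m`.

The decisive device is to regard all the `Q_m` as one polynomial `Q` over the ring of subexponential
sequences. The hypergeometric factors likewise form polynomials `cellPoly N` over this ring, with `N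
= n - 1 - j`. By Chu–Vandermonde the value of `cellPoly N` at `1` is `(N+1)_N / (|m|+1)_N`, a unit
of the ring because its inverse is polynomial in `|m|`. Successive division by `1 - X` therefore
expands `Q` as `∑ k_j (1 - X)^j cellPoly (n - 1 - j)` with the `k_j` in the same ring, which is the
growth condition (`Polynomial.exists_eq_sum_one_sub_X_pow_mul`).

Subexponential growth absorbs the polynomial factors that differentiation produces, so each series
converges with all its derivatives on smaller discs. The operator can then be applied term by term,
and on a single term the coefficient recurrence makes it telescope to zero. -/

lemma isOpen_unitDisc : IsOpen unitDisc := Metric.isOpen_ball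

lemma mem_unitDisc_iff {z : ℂ} : z ∈ unitDisc ↔ ‖z‖ < 1 := by simp [unitDisc]

lemma conj_mem_unitDisc {z : ℂ} (hz : z ∈ unitDisc) : conj z ∈ unitDisc := by
  rw [mem_unitDisc_iff] at *
  simpa using hz

lemma wirtingerBar_eq_of_hasFDerivAt {f : ℂ → ℂ} {L : ℂ →L[ℝ] ℂ} {z : ℂ}
    (h : HasFDerivAt f L z) : wirtingerBar f z = (L 1 + Complex.I * L Complex.I) / 2 := by
  rw [wirtingerBar, h.fderiv]

lemma wirtinger_eq_of_hasFDerivAt {f : ℂ → ℂ} {L : ℂ →L[ℝ] ℂ} {z : ℂ}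
    (h : HasFDerivAt f L z) : wirtinger f z = (L 1 - Complex.I * L Complex.I) / 2 := by
  rw [wirtinger, h.fderiv]

lemma hasFDerivAt_mul_comp_conj {f g : ℂ → ℂ} {a b z : ℂ} (hf : HasDerivAt f a z)
    (hg : HasDerivAt g b (conj z)) :
    HasFDerivAt (𝕜 := ℝ) (fun w => f w * g (conj w))
      (f z • b • (Complex.conjCLE : ℂ →L[ℝ] ℂ) +
        g (conj z) • a • (ContinuousLinearMap.id ℝ ℂ)) z := by
  have h1 : HasFDerivAt (𝕜 := ℝ) f (a • (ContinuousLinearMap.id ℝ ℂ)) z := by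
    convert hf.complexToReal_fderiv using 1
    ext; simp
  have h2 : HasFDerivAt (𝕜 := ℝ) (fun w => g (conj w))
      (b • (Complex.conjCLE : ℂ →L[ℝ] ℂ)) z := by
    have h3 : HasFDerivAt (𝕜 := ℝ) g (b • (ContinuousLinearMap.id ℝ ℂ)) (conj z) := by
      convert hg.complexToReal_fderiv using 1
      ext; simp
    exact (h3.comp z (Complex.conjCLE : ℂ →L[ℝ] ℂ).hasFDerivAt).congr_fderiv (by ext; simp)
  exact h1.mul h2

lemma wirtingerBar_mul_comp_conj {f g : ℂ → ℂ} {a b z : ℂ} (hf : HasDerivAt f a z)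
    (hg : HasDerivAt g b (conj z)) :
    wirtingerBar (fun w => f w * g (conj w)) z = f z * b := by
  rw [wirtingerBar_eq_of_hasFDerivAt (hasFDerivAt_mul_comp_conj hf hg)]
  simp
  linear_combination (-(f z * b) / 2 + g (conj z) * a / 2) * Complex.I_sq

lemma wirtinger_mul_comp_conj {f g : ℂ → ℂ} {a b z : ℂ} (hf : HasDerivAt f a z)
    (hg : HasDerivAt g b (conj z)) :
    wirtinger (fun w => f w * g (conj w)) z = a * g (conj z) := by
  rw [wirtinger_eq_of_hasFDerivAt (hasFDerivAt_mul_comp_conj hf hg)]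
  simp
  linear_combination (f z * b / 2 - g (conj z) * a / 2) * Complex.I_sq

/-- Conjugating the variable exchanges the two derivatives, so only `∂̄` ever has to be integrated.
-/
lemma wirtingerBar_comp_conj (f : ℂ → ℂ) :
    wirtingerBar (f ∘ conj) = wirtinger f ∘ conj := by
  ext z
  have h := Complex.conjCLE.comp_right_fderiv (f := f) (x := z)
  have h' : fderiv ℝ (f ∘ conj) z =
      (fderiv ℝ f (conj z)).comp (Complex.conjCLE : ℂ →L[ℝ] ℂ) := h
  simp [wirtingerBar, wirtinger, h', sub_eq_add_neg]

lemma wirtingerBar_iterate_comp_conj (n : ℕ) (f : ℂ → ℂ) :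
    wirtingerBar^[n] (f ∘ conj) = wirtinger^[n] f ∘ conj :=
  ((show Function.Semiconj (fun f : ℂ → ℂ => f ∘ conj) wirtinger wirtingerBar from
    fun f => (wirtingerBar_comp_conj f).symm).iterate_right n f).symm

lemma wirtingerBar_sub {f g : ℂ → ℂ} {z : ℂ} (hf : DifferentiableAt ℝ f z)
    (hg : DifferentiableAt ℝ g z) :
    wirtingerBar (fun w => f w - g w) z = wirtingerBar f z - wirtingerBar g z := by
  rw [wirtingerBar_eq_of_hasFDerivAt (hf.hasFDerivAt.fun_sub hg.hasFDerivAt)]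
  simp [wirtingerBar]
  ring

lemma wirtingerBar_add {f g : ℂ → ℂ} {z : ℂ} (hf : DifferentiableAt ℝ f z)
    (hg : DifferentiableAt ℝ g z) :
    wirtingerBar (fun w => f w + g w) z = wirtingerBar f z + wirtingerBar g z := by
  rw [wirtingerBar_eq_of_hasFDerivAt (hf.hasFDerivAt.fun_add hg.hasFDerivAt)]
  simp [wirtingerBar]
  ring

lemma wirtingerBar_sum {ι : Type*} (s : Finset ι) {f : ι → ℂ → ℂ} {z : ℂ}
    (hf : ∀ i ∈ s, DifferentiableAt ℝ (f i) z) :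
    wirtingerBar (fun w => ∑ i ∈ s, f i w) z = ∑ i ∈ s, wirtingerBar (f i) z := by
  rw [wirtingerBar_eq_of_hasFDerivAt (HasFDerivAt.fun_sum fun i hi => (hf i hi).hasFDerivAt)]
  simp [wirtingerBar, ← Finset.sum_div, Finset.mul_sum, Finset.sum_add_distrib]

lemma contDiffOn_wirtingerBar {n : ℕ} {f : ℂ → ℂ}
    (hf : ContDiffOn ℝ ((n + 1 : ℕ) : WithTop ℕ∞) f unitDisc) :
    ContDiffOn ℝ (n : WithTop ℕ∞) (wirtingerBar f) unitDisc := by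
  have h : ContDiffOn ℝ (n : WithTop ℕ∞) (fderiv ℝ f) unitDisc :=
    hf.fderiv_of_isOpen isOpen_unitDisc (by norm_cast)
  unfold wirtingerBar
  exact ((h.clm_apply contDiffOn_const).add
    (contDiffOn_const.mul (h.clm_apply contDiffOn_const))).div_const 2

lemma contDiffOn_wirtingerBar_iterate {n : ℕ} (k : ℕ) {f : ℂ → ℂ}
    (hf : ContDiffOn ℝ ((n + k : ℕ) : WithTop ℕ∞) f unitDisc) :
    ContDiffOn ℝ (n : WithTop ℕ∞) (wirtingerBar^[k] f) unitDisc := by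
  induction k generalizing f with
  | zero => simpa using hf
  | succ k ih => exact ih (contDiffOn_wirtingerBar (n := n + k) hf)

lemma differentiableAt_of_wirtingerBar_eq_zero {f : ℂ → ℂ} {z : ℂ}
    (hf : DifferentiableAt ℝ f z) (h : wirtingerBar f z = 0) : DifferentiableAt ℂ f z := by
  rw [differentiableAt_complex_iff_differentiableAt_real]
  refine ⟨hf, ?_⟩
  simp only [wirtingerBar] at h
  simp only [smul_eq_mul]
  linear_combination (-2 * Complex.I) * h + fderiv ℝ f z Complex.I * Complex.I_sq

lemma DifferentiableOn.differentiableAt_unitDisc {f : ℂ → ℂ} (hf : DifferentiableOn ℂ f unitDisc)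
    {z : ℂ} (hz : z ∈ unitDisc) : DifferentiableAt ℂ f z :=
  (hf z hz).differentiableAt (isOpen_unitDisc.mem_nhds hz)

/-- If `∂̄ᴺ u` is a polynomial in `z` with antiholomorphic coefficients, then `u` is the sum of a
function of the same kind and a polynomial in `z̄` of degree less than `N` with holomorphic
coefficients. -/
theorem exists_eq_of_wirtingerBar_iterate_eq (n N : ℕ) {u : ℂ → ℂ} {g : ℕ → ℂ → ℂ}
    (hu : ContDiffOn ℝ (N : WithTop ℕ∞) u unitDisc)
    (hg : ∀ k, DifferentiableOn ℂ (g k) unitDisc)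
    (h : ∀ z ∈ unitDisc, wirtingerBar^[N] u z = ∑ k ∈ Finset.range n, z ^ k * g k (conj z)) :
    ∃ G f : ℕ → ℂ → ℂ, (∀ k, DifferentiableOn ℂ (G k) unitDisc) ∧
      (∀ k, DifferentiableOn ℂ (f k) unitDisc) ∧
      ∀ z ∈ unitDisc, u z = ∑ k ∈ Finset.range n, z ^ k * G k (conj z) +
        ∑ k ∈ Finset.range N, f k z * conj z ^ k := by
  induction N generalizing u with
  | zero => exact ⟨g, 0, hg, fun k => differentiableOn_const 0, fun z hz => by simpa using h z hz⟩
  | succ N ih =>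
    obtain ⟨G, f, hG, hf, huv⟩ := ih (contDiffOn_wirtingerBar hu) h
    -- Holomorphic primitives on the disc: `z^k P_k(z̄)` is a `∂̄`-primitive of `z^k G_k(z̄)`.
    choose P hP using fun k => (hG k).isExactOn_ball
    have hP' : ∀ k, ∀ z ∈ unitDisc, HasDerivAt (P k) (G k z) z := hP
    set A : ℕ → ℂ → ℂ := fun k z => z ^ k * P k (conj z) with hA
    set B : ℕ → ℂ → ℂ := fun k z => f k z * ((k + 1 : ℂ)⁻¹ * conj z ^ (k + 1)) with hB
    have hpow : ∀ (k : ℕ) (w : ℂ),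
        HasDerivAt (fun w : ℂ => (k + 1 : ℂ)⁻¹ * w ^ (k + 1)) (w ^ k) w := by
      intro k w
      have hk : (k + 1 : ℂ) ≠ 0 := by exact_mod_cast k.succ_ne_zero
      refine ((hasDerivAt_pow (k + 1) w).const_mul _).congr_deriv ?_
      push_cast
      rw [inv_mul_cancel_left₀ hk]
    have dA : ∀ k, ∀ z ∈ unitDisc, DifferentiableAt ℝ (A k) z := fun k z hz =>
      (hasFDerivAt_mul_comp_conj (hasDerivAt_pow k z)
        (hP' k _ (conj_mem_unitDisc hz))).differentiableAt
    have dB : ∀ k, ∀ z ∈ unitDisc, DifferentiableAt ℝ (B k) z := fun k z hz =>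
      (hasFDerivAt_mul_comp_conj (g := fun w => (k + 1 : ℂ)⁻¹ * w ^ (k + 1))
        ((hf k).differentiableAt_unitDisc hz).hasDerivAt (hpow k (conj z))).differentiableAt
    have wA : ∀ k, ∀ z ∈ unitDisc, wirtingerBar (A k) z = z ^ k * G k (conj z) := fun k z hz =>
      wirtingerBar_mul_comp_conj (hasDerivAt_pow k z) (hP' k _ (conj_mem_unitDisc hz))
    have wB : ∀ k, ∀ z ∈ unitDisc, wirtingerBar (B k) z = f k z * conj z ^ k := fun k z hz =>
      wirtingerBar_mul_comp_conj (g := fun w => (k + 1 : ℂ)⁻¹ * w ^ (k + 1))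
        ((hf k).differentiableAt_unitDisc hz).hasDerivAt (hpow k (conj z))
    -- `H` is a `∂̄`-primitive of `∂̄u`, so `u - H` is holomorphic and supplies the coefficient of
    -- `z̄^0`.
    set H : ℂ → ℂ := fun z => ∑ k ∈ Finset.range n, A k z + ∑ k ∈ Finset.range N, B k z with hH
    have hol : DifferentiableOn ℂ (fun z => u z - H z) unitDisc := by
      intro z hz
      have d1 : DifferentiableAt ℝ u z :=
        (hu.differentiableOn (by exact_mod_cast N.succ_ne_zero) z hz).differentiableAt
          (isOpen_unitDisc.mem_nhds hz)
      have d2 : DifferentiableAt ℝ (fun z => ∑ k ∈ Finset.range n, A k z) z :=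
        DifferentiableAt.fun_sum fun k _ => dA k z hz
      have d3 : DifferentiableAt ℝ (fun z => ∑ k ∈ Finset.range N, B k z) z :=
        DifferentiableAt.fun_sum fun k _ => dB k z hz
      have d4 : DifferentiableAt ℝ H z := d2.fun_add d3
      refine (differentiableAt_of_wirtingerBar_eq_zero (d1.fun_sub d4)
        ?_).differentiableWithinAt
      rw [wirtingerBar_sub d1 d4, huv z hz, hH, wirtingerBar_add d2 d3,
        wirtingerBar_sum _ fun k _ => dA k z hz, wirtingerBar_sum _ fun k _ => dB k z hz,
        Finset.sum_congr rfl fun k _ => wA k z hz, Finset.sum_congr rfl fun k _ => wB k z hz,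
        sub_self]
    refine ⟨P, fun k => Nat.casesOn k (fun z => u z - H z) fun k z => (k + 1 : ℂ)⁻¹ * f k z,
      fun k z hz => (hP' k z hz).differentiableAt.differentiableWithinAt, ?_, ?_⟩
    · rintro (_ | k)
      · exact hol
      · exact (hf k).const_mul _
    · intro z hz
      rw [Finset.sum_range_succ']
      have : ∀ k ∈ Finset.range N,
          (k + 1 : ℂ)⁻¹ * f k z * conj z ^ (k + 1) = B k z := fun k _ => by
        simp only [hB]; ring
      simp only [pow_zero, mul_one]
      rw [Finset.sum_congr rfl this]
      change u z = ∑ k ∈ Finset.range n, A k z + (∑ k ∈ Finset.range N, B k z + (u z - H z))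
      simp only [hH]
      ring

/-- A polyharmonic function on the disc is a finite sum of products of powers of `z` with
antiholomorphic functions and of products of powers of `z̄` with holomorphic functions. -/
theorem IsPolyharmonic.exists_eq {n : ℕ} {u : ℂ → ℂ} (hu : IsPolyharmonic n u) :
    ∃ G f : ℕ → ℂ → ℂ, (∀ k, DifferentiableOn ℂ (G k) unitDisc) ∧
      (∀ k, DifferentiableOn ℂ (f k) unitDisc) ∧
      ∀ z ∈ unitDisc, u z = ∑ k ∈ Finset.range n, z ^ k * G k (conj z) +
        ∑ k ∈ Finset.range n, f k z * conj z ^ k := by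
  obtain ⟨hu, h⟩ := hu
  have hv : ContDiffOn ℝ (n : WithTop ℕ∞) (wirtingerBar^[n] u) unitDisc :=
    contDiffOn_wirtingerBar_iterate n (by simpa [two_mul] using hu)
  have hv' : ContDiffOn ℝ (n : WithTop ℕ∞) ((wirtingerBar^[n] u) ∘ conj) unitDisc :=
    hv.comp Complex.conjCLE.contDiff.contDiffOn fun z hz => conj_mem_unitDisc hz
  -- After conjugation the equation reads `∂̄ⁿ((∂̄ⁿu) ∘ conj) = 0`. Integrating this and conjugating
  -- back puts `∂̄ⁿu` in the form needed for the second integration.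
  obtain ⟨_, g, -, hg, hgv⟩ := exists_eq_of_wirtingerBar_iterate_eq 0 n (g := 0) hv'
    (fun _ => differentiableOn_const 0) fun z hz => by
      rw [wirtingerBar_iterate_comp_conj]
      simpa using h _ (conj_mem_unitDisc hz)
  refine exists_eq_of_wirtingerBar_iterate_eq n n (hu.of_le ?_) hg fun z hz => ?_
  · norm_cast; omega
  · simpa [mul_comm] using hgv _ (conj_mem_unitDisc hz)

/-! ### Division by powers of `1 - X` -/

open Polynomial in
/-- Expansion of a polynomial of degree less than `n` in powers of `1 - X` with prescribed
polynomial factors that do not vanish at `1`. -/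
theorem Polynomial.exists_eq_sum_one_sub_X_pow_mul {R : Type*} [CommRing R] (n : ℕ) (F : ℕ → R[X])
    (hF : ∀ j < n, IsUnit ((F j).eval 1)) (hd : ∀ j < n, (F j).natDegree + j < n) (Q : R[X])
    (hQ : Q.degree < n) :
    ∃ k : ℕ → R, Q = ∑ j ∈ Finset.range n, C (k j) * (1 - X) ^ j * F j := by
  nontriviality R
  induction n generalizing F Q with
  | zero => exact ⟨0, by simpa using hQ⟩
  | succ n ih =>
    obtain ⟨v, hv⟩ := (hF 0 n.succ_pos).exists_right_inv
    -- The constant is `Q(1) / F₀(1)`, which makes `P` vanish at `1`. The quotient by `1 - X` is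
    -- then expanded by induction; the sign below turns `X - 1` into `1 - X`.
    set P : R[X] := Q - C (Q.eval 1 * v) * F 0 with hP
    have hroot : P.IsRoot 1 := by
      simp only [hP, IsRoot.def, eval_sub, eval_mul, eval_C]
      linear_combination -(Q.eval 1) * hv
    have hPd : P.natDegree ≤ n := by
      refine (natDegree_sub_le _ _).trans (max_le ?_ ?_)
      · exact natDegree_le_iff_coeff_eq_zero.mpr (degree_lt_iff_coeff_zero Q (n + 1) |>.mp hQ)
      · exact (natDegree_C_mul_le _ _).trans (Nat.lt_succ_iff.mp (hd 0 n.succ_pos))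
    obtain ⟨k, hk⟩ := ih (fun j => F (j + 1)) (fun j hj => hF _ (by omega))
      (fun j hj => by have := hd (j + 1) (by omega); omega) (-(P /ₘ (X - C 1))) (by
        rw [degree_neg]
        by_cases h0 : P = 0
        · simp [h0, bot_lt_iff_ne_bot]
        · refine lt_of_lt_of_le (degree_divByMonic_lt P _ h0 (by rw [degree_X_sub_C]; exact one_pos)) ?_
          exact degree_le_of_natDegree_le hPd)
    refine ⟨fun j => Nat.casesOn j (Q.eval 1 * v) k, ?_⟩
    rw [Finset.sum_range_succ']
    have h1 := mul_divByMonic_eq_iff_isRoot.mpr hroot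
    have h2 : ∑ j ∈ Finset.range n, C (k j) * (1 - X) ^ (j + 1) * F (j + 1) =
        (1 - X) * -(P /ₘ (X - C 1)) := by
      rw [hk, Finset.mul_sum]
      exact Finset.sum_congr rfl fun j _ => by ring
    change Q = ∑ j ∈ Finset.range n, C (k j) * (1 - X) ^ (j + 1) * F (j + 1) +
      C (Q.eval 1 * v) * (1 - X) ^ 0 * F 0
    rw [h2]
    linear_combination -h1 + hP - (P /ₘ (X - C 1)) * (C_1 : (C 1 : R[X]) = 1)

/-! ### The ring of subexponential sequences -/

/-- The two-sided sequences of subexponential growth. -/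
def subexponential : Subalgebra ℂ (ℤ → ℂ) where
  carrier := {a | ∀ r : ℝ, 0 < r → r < 1 → ∃ C, ∀ m, ‖a m‖ * r ^ m.natAbs ≤ C}
  mul_mem' := by
    intro a b ha hb r h0 h1
    obtain ⟨A, hA⟩ := ha (√r) (by positivity) (by rw [Real.sqrt_lt' one_pos]; simpa)
    obtain ⟨B, hB⟩ := hb (√r) (by positivity) (by rw [Real.sqrt_lt' one_pos]; simpa)
    refine ⟨A * B, fun m => ?_⟩
    calc ‖(a * b) m‖ * r ^ m.natAbs
        = (‖a m‖ * √r ^ m.natAbs) * (‖b m‖ * √r ^ m.natAbs) := by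
          have : r ^ m.natAbs = √r ^ m.natAbs * √r ^ m.natAbs := by
            rw [← mul_pow, Real.mul_self_sqrt h0.le]
          rw [Pi.mul_apply, norm_mul, this]; ring
      _ ≤ A * B := mul_le_mul (hA m) (hB m) (by positivity)
          (le_trans (by positivity) (hA m))
  add_mem' := by
    intro a b ha hb r h0 h1
    obtain ⟨A, hA⟩ := ha r h0 h1
    obtain ⟨B, hB⟩ := hb r h0 h1
    refine ⟨A + B, fun m => ?_⟩
    calc ‖(a + b) m‖ * r ^ m.natAbs ≤ (‖a m‖ + ‖b m‖) * r ^ m.natAbs := by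
          gcongr; exact norm_add_le _ _
      _ ≤ A + B := by rw [add_mul]; exact add_le_add (hA m) (hB m)
  algebraMap_mem' := by
    intro c r h0 h1
    refine ⟨‖c‖, fun m => ?_⟩
    exact mul_le_of_le_one_right (norm_nonneg c) (pow_le_one₀ h0.le h1.le)

lemma mem_subexponential_of_bounded {a : ℤ → ℂ} {C : ℝ} (h : ∀ m, ‖a m‖ ≤ C) :
    a ∈ subexponential := fun _ h0 h1 => ⟨C, fun m =>
  (mul_le_of_le_one_right (norm_nonneg _) (pow_le_one₀ h0.le h1.le)).trans (h m)⟩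

lemma natAbs_mem_subexponential : (fun m : ℤ => (m.natAbs : ℂ)) ∈ subexponential := by
  intro r h0 h1
  obtain ⟨C, hC⟩ := (tendsto_self_mul_const_pow_of_lt_one h0.le h1).bddAbove_range
  refine ⟨C, fun m => ?_⟩
  simpa using hC ⟨m.natAbs, rfl⟩

lemma const_mem_subexponential (c : ℂ) : (fun _ : ℤ => c) ∈ subexponential :=
  subexponential.algebraMap_mem c

lemma ascPochhammer_mem_subexponential {a : ℤ → ℂ} (ha : a ∈ subexponential) (k : ℕ) :
    (fun m => (ascPochhammer ℂ k).eval (a m)) ∈ subexponential := by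
  induction k with
  | zero => simpa using const_mem_subexponential 1
  | succ k ih =>
    simp only [ascPochhammer_succ_eval]
    exact subexponential.mul_mem ih (subexponential.add_mem ha (const_mem_subexponential k))

/-- The value is a positive integer. This bounds the reciprocals of the hypergeometric denominators
uniformly in `m`. -/
lemma one_le_norm_ascPochhammer_natCast_add_one (M k : ℕ) :
    1 ≤ ‖(ascPochhammer ℂ k).eval ((M : ℂ) + 1)‖ := by
  have h : (ascPochhammer ℂ k).eval ((M : ℂ) + 1) = ((M + 1).ascFactorial k : ℕ) := by
    rw [← ascPochhammer_nat_eq_ascFactorial, ← Nat.cast_succ, ascPochhammer_eval_cast]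
  rw [h, Complex.norm_natCast]
  exact_mod_cast Nat.ascFactorial_pos M k

lemma rootLimsupLeOne_of_mem_subexponential {a : ℤ → ℂ} (ha : a ∈ subexponential) :
    RootLimsupLeOne a := by
  have hN : Filter.Tendsto (fun m : ℤ => m.natAbs) Filter.cofinite Filter.atTop := by
    rw [← Nat.cofinite_eq_atTop]
    exact Filter.Tendsto.cofinite_of_finite_preimage_singleton fun n =>
      (Set.Finite.subset (Set.finite_Icc (-(n : ℤ)) n) fun m hm => by
        simp at hm; simp; omega)
  refine le_of_forall_gt_imp_ge_of_dense fun c hc => ?_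
  obtain ⟨c', h1c, hcc⟩ := exists_between hc
  lift c' to NNReal using hcc.ne_top
  have h1c' : (1 : ℝ) < c' := by exact_mod_cast h1c
  -- With `1 < d < c'`, the growth bound at `r = 1/d` gives `|a m| ≤ C d^|m|`, and this is at most
  -- `c'^|m|` once `(c'/d)^|m| ≥ C`.
  obtain ⟨d, hd1, hdc⟩ := exists_between h1c'
  obtain ⟨C, hC⟩ := ha d⁻¹ (by positivity) (inv_lt_one_of_one_lt₀ hd1)
  refine le_trans (Filter.limsup_le_of_le (by isBoundedDefault) (a := (c' : ℝ≥0∞)) ?_) hcc.le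
  have hpow : Filter.Tendsto (fun m : ℤ => (c' / d : ℝ) ^ m.natAbs) Filter.cofinite Filter.atTop :=
    (tendsto_pow_atTop_atTop_of_one_lt ((one_lt_div (by linarith)).mpr hdc)).comp hN
  filter_upwards [hpow.eventually_ge_atTop C, hN.eventually_ge_atTop 1] with m hm hm1
  have hd0 : 0 < d := by linarith
  have h2 : ‖a m‖ ≤ (c' : ℝ) ^ m.natAbs := by
    have h3 := (hC m).trans hm
    rw [inv_pow, div_pow] at h3
    have h4 : 0 < d ^ m.natAbs := by positivity
    rw [← div_eq_mul_inv] at h3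
    exact (div_le_div_iff_of_pos_right h4).mp h3
  have h5 : ‖a m‖ₑ ≤ (c' : ℝ≥0∞) ^ m.natAbs := by
    rw [enorm_eq_nnnorm]
    exact_mod_cast h2
  calc ‖a m‖ₑ ^ (1 / (m.natAbs : ℝ)) ≤ ((c' : ℝ≥0∞) ^ m.natAbs) ^ (1 / (m.natAbs : ℝ)) := by
        gcongr
    _ = c' := by
        rw [← ENNReal.rpow_natCast, ← ENNReal.rpow_mul, mul_one_div_cancel, ENNReal.rpow_one]
        exact_mod_cast (by omega : m.natAbs ≠ 0)

/-! ### The hypergeometric polynomials -/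

lemma ascPochhammer_succ_eval_left {R : Type*} [CommRing R] (k : ℕ) (x : R) :
    (ascPochhammer R (k + 1)).eval x = x * (ascPochhammer R k).eval (x + 1) := by
  simp [ascPochhammer_succ_left]

/-- The Chu–Vandermonde identity. -/
theorem sum_choose_mul_ascPochhammer_div {K : Type*} [Field K] (N : ℕ) (b c : K)
    (hc : ∀ k : ℕ, c + k ≠ 0) :
    ∑ k ∈ Finset.range (N + 1), (-1) ^ k * (N.choose k : K) *
      ((ascPochhammer K k).eval b / (ascPochhammer K k).eval c) =
      (ascPochhammer K N).eval (c - b) / (ascPochhammer K N).eval c := by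
  induction N generalizing b c with
  | zero => simp
  | succ N ih =>
    have hc' : ∀ k : ℕ, c + 1 + k ≠ 0 := fun k => by
      have := hc (k + 1); push_cast at this; rwa [add_assoc, add_comm 1]
    have hne : ∀ k : ℕ, ∀ d : K, (∀ k : ℕ, d + k ≠ 0) → (ascPochhammer K k).eval d ≠ 0 := by
      intro k d hd
      induction k with
      | zero => simp
      | succ k ihk => rw [ascPochhammer_succ_eval]; exact mul_ne_zero ihk (hd k)
    have h1 := ih b c hc
    have h2 := ih (b + 1) (c + 1) hc'
    have hc0 : c ≠ 0 := by simpa using hc 0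
    rw [Finset.sum_range_succ']
    -- Pascal's rule yields `S(N+1; b, c) = S(N; b, c) - (b/c) S(N; b+1, c+1)` for the sum `S` on
    -- the left.
    have h3 : ∀ k ∈ Finset.range (N + 1), (-1 : K) ^ (k + 1) * ((N + 1).choose (k + 1) : K) *
        ((ascPochhammer K (k + 1)).eval b / (ascPochhammer K (k + 1)).eval c) =
        (-(b / c)) * ((-1) ^ k * (N.choose k : K) *
          ((ascPochhammer K k).eval (b + 1) / (ascPochhammer K k).eval (c + 1))) +
        (-1 : K) ^ (k + 1) * (N.choose (k + 1) : K) *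
          ((ascPochhammer K (k + 1)).eval b / (ascPochhammer K (k + 1)).eval c) := by
      intro k _
      rw [Nat.choose_succ_succ, ascPochhammer_succ_eval_left k b,
        ascPochhammer_succ_eval_left k c]
      push_cast
      have := hne k _ hc'
      field_simp
      ring
    -- The top summand vanishes because `N.choose (N + 1) = 0`; the added `1` is the term of index
    -- `0`.
    have h4 : ∑ k ∈ Finset.range (N + 1), (-1 : K) ^ (k + 1) * (N.choose (k + 1) : K) *
          ((ascPochhammer K (k + 1)).eval b / (ascPochhammer K (k + 1)).eval c) + 1 =
        (ascPochhammer K N).eval (c - b) / (ascPochhammer K N).eval c := by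
      rw [← h1, Finset.sum_range_succ, Finset.sum_range_succ' _ N]
      simp
    rw [Finset.sum_congr rfl h3, Finset.sum_add_distrib, ← Finset.mul_sum, h2, add_assoc]
    simp only [pow_zero, Nat.choose_zero_right, Nat.cast_one, mul_one, ascPochhammer_zero,
      Polynomial.eval_one, div_one]
    rw [h4, ascPochhammer_succ_eval_left N c, ascPochhammer_succ_eval N (c - b),
      show c + 1 - (b + 1) = c - b by ring]
    have e1 := hne N _ hc'
    have e2 := hne N _ hc
    have e3 : (ascPochhammer K N).eval c * (c + N) = c * (ascPochhammer K N).eval (c + 1) := by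
      rw [← ascPochhammer_succ_eval_left, ascPochhammer_succ_eval]
    have e4 : (ascPochhammer K N).eval (c - b) / (ascPochhammer K N).eval c =
        (ascPochhammer K N).eval (c - b) * (c + N) / (c * (ascPochhammer K N).eval (c + 1)) := by
      rw [← e3, mul_div_mul_right _ _ (hc N)]
    rw [e4]
    field_simp
    ring

/-- The `i`-th coefficient of `x ↦ F(-N, |m| - N, |m| + 1; x)`. -/
noncomputable def cellCoeff (N i : ℕ) (m : ℤ) : ℂ :=
  (i.factorial : ℂ)⁻¹ * (ascPochhammer ℂ i).eval (-(N : ℂ)) *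
    (ascPochhammer ℂ i).eval ((m.natAbs : ℂ) - N) *
    ((ascPochhammer ℂ i).eval ((m.natAbs : ℂ) + 1))⁻¹

lemma cellCoeff_mem_subexponential (N i : ℕ) : cellCoeff N i ∈ subexponential := by
  refine subexponential.mul_mem (subexponential.mul_mem (const_mem_subexponential _)
    (ascPochhammer_mem_subexponential
      (subexponential.sub_mem natAbs_mem_subexponential (const_mem_subexponential N)) i))
    (mem_subexponential_of_bounded (C := 1) fun m => ?_)
  rw [norm_inv]
  exact inv_le_one_of_one_le₀ (one_le_norm_ascPochhammer_natCast_add_one _ _)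

lemma ascPochhammer_eval_neg_natCast (N i : ℕ) :
    (ascPochhammer ℂ i).eval (-(N : ℂ)) = (-1) ^ i * (i.factorial * N.choose i : ℂ) := by
  rw [ascPochhammer_eval_neg_eq_descPochhammer, descPochhammer_eval_eq_descFactorial,
    Nat.descFactorial_eq_factorial_mul_choose]
  push_cast
  ring

lemma cellCoeff_eq (N i : ℕ) (m : ℤ) : cellCoeff N i m = (-1) ^ i * (N.choose i : ℂ) *
    ((ascPochhammer ℂ i).eval ((m.natAbs : ℂ) - N) /
      (ascPochhammer ℂ i).eval ((m.natAbs : ℂ) + 1)) := by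
  have : (i.factorial : ℂ) ≠ 0 := by exact_mod_cast i.factorial_ne_zero
  rw [cellCoeff, ascPochhammer_eval_neg_natCast]
  field_simp

lemma cellCoeff_eq_zero {N i : ℕ} (h : N < i) (m : ℤ) : cellCoeff N i m = 0 := by
  rw [cellCoeff_eq, Nat.choose_eq_zero_of_lt h]
  simp

/-- The hypergeometric recurrence, cleared of denominators; it drives the telescoping in
`harmonicOp_cellCoeff`. -/
lemma cellCoeff_succ (N i : ℕ) (m : ℤ) :
    ((i : ℂ) + 1) * (m.natAbs + i + 1) * cellCoeff N (i + 1) m =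
      ((i : ℂ) - N) * (m.natAbs + i - N) * cellCoeff N i m := by
  have h0 : (i.factorial : ℂ) ≠ 0 := by exact_mod_cast i.factorial_ne_zero
  have h1 : (ascPochhammer ℂ i).eval ((m.natAbs : ℂ) + 1) ≠ 0 :=
    norm_pos_iff.mp (one_pos.trans_le (one_le_norm_ascPochhammer_natCast_add_one _ _))
  have h2 : (m.natAbs : ℂ) + 1 + i ≠ 0 := by exact_mod_cast (by omega : m.natAbs + 1 + i ≠ 0)
  have h3 : (i : ℂ) + 1 ≠ 0 := by exact_mod_cast i.succ_ne_zero
  simp only [cellCoeff, ascPochhammer_succ_eval, Nat.factorial_succ]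
  push_cast
  field_simp
  ring

/-- Evaluation of subexponential sequences at an index. -/
noncomputable def subexponentialEval (m : ℤ) : subexponential →+* ℂ :=
  (Pi.evalRingHom (fun _ : ℤ => ℂ) m).comp subexponential.subtype

@[simp] lemma subexponentialEval_apply (m : ℤ) (a : subexponential) :
    subexponentialEval m a = (a : ℤ → ℂ) m := rfl

open Polynomial in
/-- The polynomials `F(-N, |m| - N, |m| + 1; X)`, `m ∈ ℤ`, as a single polynomial with
coefficients in the subexponential sequences. -/
noncomputable def cellPoly (N : ℕ) : subexponential[X] :=
  ∑ i ∈ Finset.range (N + 1), C ⟨cellCoeff N i, cellCoeff_mem_subexponential N i⟩ * X ^ i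

lemma natDegree_cellPoly_le (N : ℕ) : (cellPoly N).natDegree ≤ N :=
  Polynomial.natDegree_sum_le_of_forall_le _ _ fun _ hi =>
    (Polynomial.natDegree_C_mul_X_pow_le _ _).trans (Finset.mem_range_succ_iff.mp hi)

lemma eval₂_cellPoly (N : ℕ) (m : ℤ) (x : ℂ) : (cellPoly N).eval₂ (subexponentialEval m) x =
    ∑ i ∈ Finset.range (N + 1), cellCoeff N i m * x ^ i := by
  simp [cellPoly, Polynomial.eval₂_finsetSum]

/-- Here `c - b = N + 1` in Chu–Vandermonde, so the inverse is `(|m|+1)_N / (N+1)_N`, a polynomial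
in `|m|`. -/
lemma isUnit_eval_one_cellPoly (N : ℕ) : IsUnit ((cellPoly N).eval 1) := by
  have hq : ∀ k, (ascPochhammer ℂ k).eval ((N : ℂ) + 1) ≠ 0 := fun k =>
    norm_pos_iff.mp (one_pos.trans_le (one_le_norm_ascPochhammer_natCast_add_one _ _))
  refine .of_mul_eq_one ⟨fun m => (ascPochhammer ℂ N).eval ((m.natAbs : ℂ) + 1) *
    ((ascPochhammer ℂ N).eval ((N : ℂ) + 1))⁻¹, subexponential.mul_mem
      (ascPochhammer_mem_subexponential (subexponential.add_mem natAbs_mem_subexponential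
        (const_mem_subexponential 1)) N) (const_mem_subexponential _)⟩ ?_
  refine Subtype.ext (funext fun m => ?_)
  have h1 : (ascPochhammer ℂ N).eval ((m.natAbs : ℂ) + 1) ≠ 0 :=
    norm_pos_iff.mp (one_pos.trans_le (one_le_norm_ascPochhammer_natCast_add_one _ _))
  have h2 : (((cellPoly N).eval 1 : subexponential) : ℤ → ℂ) m =
      (ascPochhammer ℂ N).eval ((N : ℂ) + 1) / (ascPochhammer ℂ N).eval ((m.natAbs : ℂ) + 1) := by
    have h3 := Polynomial.eval₂_at_apply (p := cellPoly N) (subexponentialEval m) 1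
    rw [map_one, eval₂_cellPoly, subexponentialEval_apply] at h3
    rw [← h3]
    simp only [one_pow, mul_one, cellCoeff_eq]
    rw [sum_choose_mul_ascPochhammer_div N _ _ fun k => by
      exact_mod_cast (by omega : m.natAbs + 1 + k ≠ 0)]
    congr 2
    ring
  change (((cellPoly N).eval 1 : subexponential) : ℤ → ℂ) m * _ = 1
  rw [h2]
  have := hq N
  field_simp

/-- The first parameter is `-(n - 1 - j)`, a nonpositive integer, so the series terminates. -/
lemma cellTerm_eq {n j : ℕ} (hj : j < n) (m : ℤ) (z : ℂ) : cellTerm n j m z =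
    (∑ i ∈ Finset.range (n - 1 - j + 1), cellCoeff (n - 1 - j) i m * ((‖z‖ : ℂ) ^ 2) ^ i) *
      xi m z := by
  have hN : ((n - 1 - j : ℕ) : ℂ) = n - 1 - j := by
    rw [Nat.cast_sub (by omega), Nat.cast_sub (by omega), Nat.cast_one]
  rw [cellTerm, ordinaryHypergeometric_eq_tsum, show -(n : ℂ) + 1 + j = -((n - 1 - j : ℕ) : ℂ) by
    rw [hN]; ring, show (m.natAbs : ℂ) - n + 1 + j = m.natAbs - ((n - 1 - j : ℕ) : ℂ) by
    rw [hN]; ring]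
  congr 1
  exact tsum_eq_sum fun i hi => by
    have := cellCoeff_eq_zero (N := n - 1 - j) (i := i) (by simpa using hi) m
    rw [cellCoeff] at this
    rw [this, zero_smul]

/-! ### Locally uniformly convergent series of smooth functions -/

section SmoothSeries

variable {ι E F : Type*} [NormedAddCommGroup E] [NormedSpace ℝ E] [NormedAddCommGroup F]
  [NormedSpace ℝ F] [CompleteSpace F]

/-- Local version of `iteratedFDeriv_tsum`, together with the differentiability of the
differentiated series. -/
theorem iteratedFDeriv_tsum_of_isPreconnected {f : ι → E → F} {s : Set E} (hs : IsOpen s)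
    (h's : IsPreconnected s) {v : ℕ → ι → ℝ} (hf : ∀ i, ContDiff ℝ ∞ (f i))
    (hv : ∀ k, Summable (v k)) (h'f : ∀ k i, ∀ x ∈ s, ‖iteratedFDeriv ℝ k (f i) x‖ ≤ v k i)
    (k : ℕ) {x : E} (hx : x ∈ s) :
    iteratedFDeriv ℝ k (fun y => ∑' i, f i y) x = ∑' i, iteratedFDeriv ℝ k (f i) x ∧
      DifferentiableAt ℝ (iteratedFDeriv ℝ k (fun y => ∑' i, f i y)) x := by
  -- The bounds of order `k + 1` dominate the series of derivatives of the order `k` terms.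
  have key : ∀ k, ∀ x ∈ s, HasFDerivAt (fun y => ∑' i, iteratedFDeriv ℝ k (f i) y)
      (∑' i, fderiv ℝ (iteratedFDeriv ℝ k (f i)) x) x := by
    intro k x hx
    refine hasFDerivAt_tsum_of_isPreconnected (hv (k + 1)) hs h's
      (fun i y _ => ((hf i).differentiable_iteratedFDeriv (m := k)
        (by exact_mod_cast WithTop.coe_lt_top _) y).hasFDerivAt) (fun i y hy => ?_) hx
      (.of_norm_bounded (hv k) fun i => h'f k i x hx) hx
    simpa only [iteratedFDeriv_succ_eq_comp_left, LinearIsometryEquiv.norm_map,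
      Function.comp_apply] using h'f (k + 1) i y hy
  have main : ∀ k, ∀ x ∈ s,
      iteratedFDeriv ℝ k (fun y => ∑' i, f i y) x = ∑' i, iteratedFDeriv ℝ k (f i) x := by
    intro k
    induction k with
    | zero =>
      intro x _
      simp_rw [iteratedFDeriv_zero_eq_comp]
      exact (continuousMultilinearCurryFin0 ℝ E F).symm.toContinuousLinearEquiv.map_tsum
    | succ k ih =>
      intro x hx
      have h : iteratedFDeriv ℝ k (fun y => ∑' i, f i y) =ᶠ[nhds x]
          fun y => ∑' i, iteratedFDeriv ℝ k (f i) y :=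
        Filter.eventuallyEq_of_mem (hs.mem_nhds hx) ih
      simp_rw [iteratedFDeriv_succ_eq_comp_left, Function.comp_apply]
      rw [h.fderiv_eq, (key k x hx).fderiv]
      exact (continuousMultilinearCurryLeftEquiv ℝ
        (fun _ : Fin (k + 1) => E) F).symm.toContinuousLinearEquiv.map_tsum
  refine ⟨main k x hx, ?_⟩
  exact (key k x hx).differentiableAt.congr_of_eventuallyEq
    (Filter.eventuallyEq_of_mem (hs.mem_nhds hx) (main k))

theorem contDiffOn_tsum_of_isPreconnected {f : ι → E → F} {s : Set E} (hs : IsOpen s)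
    (h's : IsPreconnected s) {v : ℕ → ι → ℝ} (hf : ∀ i, ContDiff ℝ ∞ (f i))
    (hv : ∀ k, Summable (v k)) (h'f : ∀ k i, ∀ x ∈ s, ‖iteratedFDeriv ℝ k (f i) x‖ ≤ v k i) :
    ContDiffOn ℝ ∞ (fun y => ∑' i, f i y) s :=
  contDiffOn_of_differentiableOn fun k _ => DifferentiableOn.congr
    (fun _ hx => (iteratedFDeriv_tsum_of_isPreconnected hs h's hf hv h'f k
      hx).2.differentiableWithinAt) (iteratedFDerivWithin_of_isOpen k hs)

end SmoothSeries

/-- The series of smooth functions `f m`, summable with all derivatives uniformly on the discs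
of radius less than `1`. -/
def SummableOnDiscs (f : ℤ → ℂ → ℂ) : Prop :=
  (∀ m, ContDiff ℝ ∞ (f m)) ∧ ∀ R : ℝ, 0 < R → R < 1 → ∃ v : ℕ → ℤ → ℝ, (∀ k, Summable (v k)) ∧
    ∀ k m, ∀ z ∈ Metric.ball (0 : ℂ) R, ‖iteratedFDeriv ℝ k (f m) z‖ ≤ v k m

lemma exists_radius {z : ℂ} (hz : z ∈ unitDisc) :
    ∃ R : ℝ, 0 < R ∧ R < 1 ∧ z ∈ Metric.ball (0 : ℂ) R := by
  obtain ⟨R, h1, h2⟩ := exists_between (mem_unitDisc_iff.mp hz)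
  exact ⟨R, (norm_nonneg z).trans_lt h1, h2, by simpa using h1⟩

namespace SummableOnDiscs

variable {f : ℤ → ℂ → ℂ}

lemma hasSum_iteratedFDeriv (hf : SummableOnDiscs f) (k : ℕ) {z : ℂ} (hz : z ∈ unitDisc) :
    HasSum (fun m => iteratedFDeriv ℝ k (f m) z)
      (iteratedFDeriv ℝ k (fun z => ∑' m, f m z) z) := by
  obtain ⟨R, h0, h1, hzR⟩ := exists_radius hz
  obtain ⟨v, hv, hb⟩ := hf.2 R h0 h1
  rw [(iteratedFDeriv_tsum_of_isPreconnected Metric.isOpen_ball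
    (convex_ball (0 : ℂ) R).isPreconnected hf.1 hv hb k hzR).1]
  exact (Summable.of_norm_bounded (hv k) fun m => hb k m z hzR).hasSum

lemma hasSum (hf : SummableOnDiscs f) {z : ℂ} (hz : z ∈ unitDisc) :
    HasSum (fun m => f m z) (∑' m, f m z) := by
  obtain ⟨R, h0, h1, hzR⟩ := exists_radius hz
  obtain ⟨v, hv, hb⟩ := hf.2 R h0 h1
  exact (Summable.of_norm_bounded (hv 0) fun m => by simpa using hb 0 m z hzR).hasSum

lemma contDiffOn (hf : SummableOnDiscs f) : ContDiffOn ℝ ∞ (fun z => ∑' m, f m z) unitDisc := by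
  intro z hz
  obtain ⟨R, h0, h1, hzR⟩ := exists_radius hz
  obtain ⟨v, hv, hb⟩ := hf.2 R h0 h1
  exact ((contDiffOn_tsum_of_isPreconnected Metric.isOpen_ball
    (convex_ball (0 : ℂ) R).isPreconnected hf.1 hv hb).contDiffAt
      (Metric.isOpen_ball.mem_nhds hzR)).contDiffWithinAt

lemma hasSmoothSum (hf : SummableOnDiscs f) : HasSmoothSum f (fun z => ∑' m, f m z) := by
  refine ⟨fun m => (hf.1 m).contDiffOn, hf.contDiffOn, fun K hK hKc r => ?_⟩
  obtain ⟨R, ⟨h0, h1⟩, hKR⟩ := exists_pos_lt_subset_ball one_pos hKc.isClosed hK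
  obtain ⟨v, hv, hb⟩ := hf.2 R h0 h1
  constructor
  · refine lt_of_le_of_lt (ENNReal.tsum_le_tsum fun m => ?_) (hv r).tsum_ofReal_lt_top
    refine iSup₂_le fun z hz => ?_
    rw [← ofReal_norm]
    exact ENNReal.ofReal_le_ofReal (hb r m z (hKR hz))
  · rw [ENNReal.tendsto_nhds_zero]
    intro ε hε
    obtain ⟨δ, hδ0, hδ⟩ := ENNReal.lt_iff_exists_nnreal_btwn.mp hε
    have hδ0' : (0 : ℝ) < δ := by exact_mod_cast hδ0
    filter_upwards [Metric.tendstoUniformlyOn_iff.mp (tendstoUniformlyOn_tsum (hv r)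
      (f := fun m => iteratedFDeriv ℝ r (f m)) (hb r)) δ hδ0'] with s hs
    refine le_trans (iSup₂_le fun z hz => ?_) hδ.le
    have hw : ContDiffAt ℝ (r : WithTop ℕ∞) (fun z => ∑' m, f m z) z :=
      (hf.contDiffOn.contDiffAt (isOpen_unitDisc.mem_nhds (hK hz))).of_le
        (by exact_mod_cast le_top)
    have hfr : ∀ m ∈ s, ContDiffAt ℝ (r : WithTop ℕ∞) (f m) z := fun m _ =>
      (hf.1 m).contDiffAt.of_le (by exact_mod_cast le_top)
    have h2 := iteratedFDeriv_sub_apply (ContDiffAt.sum hfr) hw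
    have h3 : iteratedFDeriv ℝ r (fun z => (∑ m ∈ s, f m z) - ∑' m, f m z) z =
        (∑ m ∈ s, iteratedFDeriv ℝ r (f m) z) - ∑' m, iteratedFDeriv ℝ r (f m) z := by
      rw [← iteratedFDeriv_fun_sum_apply hfr, (hf.hasSum_iteratedFDeriv r (hK hz)).tsum_eq]
      exact h2
    rw [h3, ← ofReal_norm, ← dist_eq_norm, dist_comm, ← ENNReal.ofReal_coe_nnreal]
    exact ENNReal.ofReal_le_ofReal (hs z (hKR hz)).le

end SummableOnDiscs

/-! ### Monomials in `z` and `z̄` -/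

/-- The monomial is the `(a + b)`-fold product map, of norm `1`, composed with a real linear map of
norm at most `1`. When `r > a + b` the descending factorial bounding the left side is zero, so the
truncated exponent is harmless. -/
lemma norm_iteratedFDeriv_pow_mul_conj_pow_le (a b r : ℕ) (z : ℂ) :
    ‖iteratedFDeriv ℝ r (fun z : ℂ => z ^ a * conj z ^ b) z‖ ≤
      (a + b : ℝ) ^ r * ‖z‖ ^ (a + b - r) := by
  let M := ContinuousMultilinearMap.mkPiAlgebra ℝ (Fin a ⊕ Fin b) ℂ
  let g : ℂ →L[ℝ] (Fin a ⊕ Fin b → ℂ) := ContinuousLinearMap.pi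
    (Sum.elim (fun _ => ContinuousLinearMap.id ℝ ℂ) fun _ => (Complex.conjCLE : ℂ →L[ℝ] ℂ))
  have hgz : ∀ z, ‖g z‖ ≤ ‖z‖ := fun z => by
    refine (pi_norm_le_iff_of_nonneg (norm_nonneg z)).mpr ?_
    rintro (i | i) <;> simp [g]
  have hg : ‖g‖ ≤ 1 := ContinuousLinearMap.opNorm_le_bound _ zero_le_one fun z => by
    simpa using hgz z
  have hfun : (fun z : ℂ => z ^ a * conj z ^ b) = M ∘ g := by
    ext z
    simp [M, g]
  rw [hfun, g.iteratedFDeriv_comp_right M.contDiff z (i := r) (n := ∞)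
    (by exact_mod_cast le_top)]
  have hM : ‖M‖ = 1 := ContinuousMultilinearMap.norm_mkPiAlgebra
  have h1 := M.norm_iteratedFDeriv_le r (g z)
  rw [hM, mul_one, Fintype.card_sum, Fintype.card_fin, Fintype.card_fin] at h1
  refine (ContinuousMultilinearMap.norm_compContinuousLinearMap_le _ _).trans ?_
  refine (mul_le_of_le_one_right (norm_nonneg _)
    (Finset.prod_le_one (fun _ _ => norm_nonneg _) fun _ _ => hg)).trans (h1.trans ?_)
  gcongr
  · exact_mod_cast Nat.descFactorial_le_pow (a + b) r
  · exact hgz z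

lemma contDiff_pow_mul_conj_pow (a b : ℕ) : ContDiff ℝ ∞ (fun z : ℂ => z ^ a * conj z ^ b) :=
  (contDiff_id.pow a).mul (Complex.conjCLE.contDiff.pow b)

lemma summable_norm_mul_pow_of_mem_subexponential {a : ℤ → ℂ} (ha : a ∈ subexponential) {R : ℝ}
    (h0 : 0 < R) (h1 : R < 1) : Summable fun m : ℤ => ‖a m‖ * R ^ m.natAbs := by
  have hs1 : √R < 1 := by rw [Real.sqrt_lt' one_pos]; simpa
  obtain ⟨C, hC⟩ := ha (√R) (by positivity) hs1
  have hgeo : Summable fun m : ℤ => √R ^ m.natAbs := by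
    have := summable_geometric_of_lt_one (Real.sqrt_nonneg R) hs1
    exact .of_nat_of_neg (by simpa using this) (by simpa using this)
  refine .of_nonneg_of_le (fun m => by positivity) (fun m => ?_) (hgeo.mul_left C)
  have : R ^ m.natAbs = √R ^ m.natAbs * √R ^ m.natAbs := by
    rw [← mul_pow, Real.mul_self_sqrt h0.le]
  rw [this, ← mul_assoc]
  gcongr
  exact hC m

lemma norm_sq_pow_mul_xi (i : ℕ) (m : ℤ) (z : ℂ) : ((‖z‖ : ℂ) ^ 2) ^ i * xi m z =
    z ^ (m.toNat + i) * conj z ^ ((-m).toNat + i) := by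
  rw [← Complex.mul_conj', xi, pow_add, pow_add, mul_pow]
  split_ifs with h
  · rw [show (-m).toNat = 0 by omega, show m.natAbs = m.toNat by omega]; ring
  · rw [show m.toNat = 0 by omega, show m.natAbs = (-m).toNat by omega]; ring

lemma summableOnDiscs_of_mem_subexponential (L : ℕ) {a : ℕ → ℤ → ℂ}
    (ha : ∀ i, a i ∈ subexponential) :
    SummableOnDiscs fun m z => ∑ i ∈ Finset.range L,
      a i m * (z ^ (m.toNat + i) * conj z ^ ((-m).toNat + i)) := by
  have hsm : ∀ i (m : ℤ), ContDiff ℝ ∞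
      (fun z : ℂ => a i m * (z ^ (m.toNat + i) * conj z ^ ((-m).toNat + i))) := fun i m =>
    contDiff_const.mul (contDiff_pow_mul_conj_pow _ _)
  refine ⟨fun m => ContDiff.sum fun i _ => hsm i m, fun R h0 h1 => ?_⟩
  -- Differentiating `r` times costs at most `r` powers of `R`, repaid by `(R ^ r)⁻¹`, and a factor
  -- `(|m| + 2i)^r`, which is subexponential.
  refine ⟨fun r m => ∑ i ∈ Finset.range L, (R ^ r)⁻¹ *
    (‖a i m * ((m.natAbs : ℂ) + (2 * i : ℂ)) ^ r‖ * R ^ m.natAbs), fun r => ?_, fun r m z hz => ?_⟩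
  · refine summable_sum fun i _ => Summable.mul_left _
      (summable_norm_mul_pow_of_mem_subexponential (subexponential.mul_mem (ha i) ?_) h0 h1)
    exact subexponential.pow_mem (subexponential.add_mem natAbs_mem_subexponential
      (const_mem_subexponential _)) r
  · rw [iteratedFDeriv_fun_sum_apply fun i _ => (hsm i m).contDiffAt.of_le
      (by exact_mod_cast le_top)]
    refine (norm_sum_le _ _).trans (Finset.sum_le_sum fun i _ => ?_)
    have hz' : ‖z‖ ≤ R := by simpa using (Metric.mem_ball.mp hz).le
    have h2 := iteratedFDeriv_const_smul_apply (𝕜 := ℝ) (i := r) (a := a i m) (x := z)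
      ((contDiff_pow_mul_conj_pow (m.toNat + i) ((-m).toNat + i)).contDiffAt.of_le
        (by exact_mod_cast le_top))
    have h3 : iteratedFDeriv ℝ r (fun z : ℂ =>
        a i m * (z ^ (m.toNat + i) * conj z ^ ((-m).toNat + i))) z = _ := h2
    have hp : m.toNat + i + ((-m).toNat + i) = m.natAbs + 2 * i := by omega
    have hpR : ((m.toNat + i : ℕ) : ℝ) + ((-m).toNat + i : ℕ) = m.natAbs + 2 * i := by
      exact_mod_cast hp
    have h4 := norm_iteratedFDeriv_pow_mul_conj_pow_le (m.toNat + i) ((-m).toNat + i) r z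
    rw [hpR, hp] at h4
    have h5 : ‖z‖ ^ (m.natAbs + 2 * i - r) ≤ (R ^ r)⁻¹ * R ^ m.natAbs := by
      refine (pow_le_pow_left₀ (norm_nonneg z) hz' _).trans ?_
      rw [le_inv_mul_iff₀ (by positivity), ← pow_add]
      exact pow_le_pow_of_le_one h0.le h1.le (by omega)
    have h6 : ‖((m.natAbs : ℂ) + (2 * i : ℂ)) ^ r‖ = ((m.natAbs : ℝ) + 2 * i) ^ r := by
      rw [norm_pow]
      congr 1
      have : (m.natAbs : ℂ) + (2 * i : ℂ) = ((m.natAbs + 2 * i : ℕ) : ℂ) := by push_cast; rfl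
      rw [this, Complex.norm_natCast]
      push_cast; rfl
    rw [h3, norm_smul, norm_mul, h6]
    calc _ ≤ ‖a i m‖ * (((m.natAbs : ℝ) + 2 * i) ^ r * ((R ^ r)⁻¹ * R ^ m.natAbs)) := by
          gcongr
          exact h4.trans (by gcongr)
      _ = _ := by ring

/-! ### The operator `L_{γ₁,γ₂}` -/

/-- This displays the operator at a point as a linear combination of iterated derivatives, so that
it passes through the series. -/
lemma harmonicOp_eq_iteratedFDeriv (γ₁ γ₂ : ℂ) {f : ℂ → ℂ} {z : ℂ} (hf : ContDiffAt ℝ 2 f z) :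
    harmonicOp γ₁ γ₂ f z = (1 - (‖z‖ : ℂ) ^ 2) / 4 *
        (iteratedFDeriv ℝ 2 f z ![1, 1] + Complex.I * iteratedFDeriv ℝ 2 f z ![1, Complex.I] -
          Complex.I * iteratedFDeriv ℝ 2 f z ![Complex.I, 1] +
          iteratedFDeriv ℝ 2 f z ![Complex.I, Complex.I]) +
      γ₁ * z / 2 * (iteratedFDeriv ℝ 1 f z ![1] -
        Complex.I * iteratedFDeriv ℝ 1 f z ![Complex.I]) +
      γ₂ * conj z / 2 * (iteratedFDeriv ℝ 1 f z ![1] +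
        Complex.I * iteratedFDeriv ℝ 1 f z ![Complex.I]) -
      γ₁ * γ₂ * iteratedFDeriv ℝ 0 f z ![] := by
  have h1 : HasFDerivAt (fderiv ℝ f) (fderiv ℝ (fderiv ℝ f) z) z :=
    ((hf.fderiv_right (m := 1) (by norm_num)).differentiableAt one_ne_zero).hasFDerivAt
  have h2 : ∀ v : ℂ, HasFDerivAt (fun w => fderiv ℝ f w v)
      ((fderiv ℝ (fderiv ℝ f) z).flip v) z := fun v =>
    (h1.clm_apply (hasFDerivAt_const v z)).congr_fderiv (by ext; simp)
  have h3 : HasFDerivAt (wirtingerBar f) ((2 : ℂ)⁻¹ • ((fderiv ℝ (fderiv ℝ f) z).flip 1 +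
      Complex.I • (fderiv ℝ (fderiv ℝ f) z).flip Complex.I)) z := by
    have := ((h2 1).fun_add ((h2 Complex.I).const_smul Complex.I)).const_smul (2 : ℂ)⁻¹
    refine this.congr_of_eventuallyEq (.of_forall fun w => ?_)
    simp [wirtingerBar]
    ring
  rw [harmonicOp, wirtinger_eq_of_hasFDerivAt h3]
  simp only [wirtinger, wirtingerBar, iteratedFDeriv_two_apply, iteratedFDeriv_one_apply,
    iteratedFDeriv_zero_apply, smul_apply, add_apply,
    ContinuousLinearMap.flip_apply, smul_eq_mul, Matrix.cons_val_zero, Matrix.cons_val_one]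
  linear_combination -((1 - (‖z‖ : ℂ) ^ 2) / 4 *
    fderiv ℝ (fderiv ℝ f) z Complex.I Complex.I) * Complex.I_sq

lemma SummableOnDiscs.isGenHarmonic {f : ℤ → ℂ → ℂ} (hf : SummableOnDiscs f) {γ₁ γ₂ : ℂ}
    (h : ∀ m, ∀ z ∈ unitDisc, harmonicOp γ₁ γ₂ (f m) z = 0) :
    IsGenHarmonic γ₁ γ₂ (fun z => ∑' m, f m z) := by
  have hc : ContDiffOn ℝ 2 (fun z => ∑' m, f m z) unitDisc :=
    hf.contDiffOn.of_le (WithTop.coe_le_coe.mpr (le_top : (2 : ℕ∞) ≤ ⊤))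
  refine ⟨hc, fun z hz => ?_⟩
  have ev : ∀ (k : ℕ) (v : Fin k → ℂ), HasSum (fun m => iteratedFDeriv ℝ k (f m) z v)
      (iteratedFDeriv ℝ k (fun z => ∑' m, f m z) z v) := fun k v =>
    (hf.hasSum_iteratedFDeriv k hz).mapL (ContinuousMultilinearMap.apply ℝ (fun _ => ℂ) ℂ v)
  rw [harmonicOp_eq_iteratedFDeriv γ₁ γ₂ (hc.contDiffAt (isOpen_unitDisc.mem_nhds hz))]
  refine HasSum.unique (((((((ev 2 ![1, 1]).add ((ev 2 ![1, Complex.I]).mul_left Complex.I)).sub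
    ((ev 2 ![Complex.I, 1]).mul_left Complex.I)).add (ev 2 ![Complex.I, Complex.I])).mul_left
    _).add (((ev 1 ![1]).sub ((ev 1 ![Complex.I]).mul_left Complex.I)).mul_left _)).add
    (((ev 1 ![1]).add ((ev 1 ![Complex.I]).mul_left Complex.I)).mul_left _) |>.sub
    ((ev 0 ![]).mul_left _)) ?_
  convert hasSum_zero using 1
  ext m
  rw [← h m z hz, harmonicOp_eq_iteratedFDeriv γ₁ γ₂
    ((hf.1 m).contDiffAt.of_le (WithTop.coe_le_coe.mpr (le_top : (2 : ℕ∞) ≤ ⊤)))]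

lemma wirtinger_sum {ι : Type*} (s : Finset ι) {f : ι → ℂ → ℂ} {z : ℂ}
    (hf : ∀ i ∈ s, DifferentiableAt ℝ (f i) z) :
    wirtinger (fun w => ∑ i ∈ s, f i w) z = ∑ i ∈ s, wirtinger (f i) z := by
  rw [wirtinger_eq_of_hasFDerivAt (HasFDerivAt.fun_sum fun i hi => (hf i hi).hasFDerivAt)]
  simp [wirtinger, ← Finset.sum_div, Finset.mul_sum, Finset.sum_sub_distrib]

/-- The factor `1 - |z|²` splits `∂∂̄` into two degrees, and the upper one combines with the
lower-order terms to `-(p - γ)(q - γ)`. Truncation in `p - 1` and `q - 1` does not matter, since `p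
* q` vanishes there. -/
lemma harmonicOp_sum_monomial (γ : ℂ) (s : Finset ℕ) (c : ℕ → ℂ) (p q : ℕ → ℕ) (z : ℂ) :
    harmonicOp γ γ (fun z => ∑ i ∈ s, c i * (z ^ p i * conj z ^ q i)) z =
      ∑ i ∈ s, c i * (p i * q i * (z ^ (p i - 1) * conj z ^ (q i - 1)) -
        (p i - γ) * (q i - γ) * (z ^ p i * conj z ^ q i)) := by
  have hz : ∀ (c : ℂ) (p : ℕ) (z : ℂ), HasDerivAt (fun w => c * w ^ p) (c * (p * z ^ (p - 1))) z :=
    fun c p z => (hasDerivAt_pow p z).const_mul c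
  have d : ∀ (c : ℂ) (p q : ℕ) (z : ℂ),
      DifferentiableAt ℝ (fun w : ℂ => c * (w ^ p * conj w ^ q)) z := fun c p q z => by
    simpa only [mul_assoc] using
      (hasFDerivAt_mul_comp_conj (hz c p z) (hasDerivAt_pow q (conj z))).differentiableAt
  have w1 : ∀ (c : ℂ) (p q : ℕ) (z : ℂ), wirtinger (fun w : ℂ => c * (w ^ p * conj w ^ q)) z =
      c * p * (z ^ (p - 1) * conj z ^ q) := fun c p q z => by
    have := wirtinger_mul_comp_conj (hz c p z) (hasDerivAt_pow q (conj z))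
    simp only [mul_assoc] at this ⊢
    exact this
  have w2 : ∀ (c : ℂ) (p q : ℕ) (z : ℂ), wirtingerBar (fun w : ℂ => c * (w ^ p * conj w ^ q)) z =
      c * q * (z ^ p * conj z ^ (q - 1)) := fun c p q z => by
    have := wirtingerBar_mul_comp_conj (hz c p z) (hasDerivAt_pow q (conj z))
    simp only [mul_assoc] at this ⊢
    rw [this]
    ring
  have h1 : ∀ z, wirtinger (fun z => ∑ i ∈ s, c i * (z ^ p i * conj z ^ q i)) z =
      ∑ i ∈ s, c i * p i * (z ^ (p i - 1) * conj z ^ q i) := fun z => by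
    rw [wirtinger_sum s fun i _ => d _ _ _ _]
    exact Finset.sum_congr rfl fun i _ => w1 _ _ _ _
  have h2 : wirtingerBar (fun z => ∑ i ∈ s, c i * (z ^ p i * conj z ^ q i)) =
      fun z => ∑ i ∈ s, c i * q i * (z ^ p i * conj z ^ (q i - 1)) := funext fun z => by
    rw [wirtingerBar_sum s fun i _ => d _ _ _ _]
    exact Finset.sum_congr rfl fun i _ => w2 _ _ _ _
  have h3 : wirtinger (fun z => ∑ i ∈ s, c i * q i * (z ^ p i * conj z ^ (q i - 1))) z =
      ∑ i ∈ s, c i * q i * p i * (z ^ (p i - 1) * conj z ^ (q i - 1)) := by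
    rw [wirtinger_sum s fun i _ => d _ _ _ _]
    exact Finset.sum_congr rfl fun i _ => w1 _ _ _ _
  have e : ∀ (p : ℕ) (z : ℂ), (p : ℂ) * z ^ p = p * (z * z ^ (p - 1)) := by
    rintro (_ | p) z
    · simp
    · rw [Nat.add_sub_cancel, pow_succ']
  rw [harmonicOp, h2, h3, h1, ← Complex.mul_conj', Finset.mul_sum, Finset.mul_sum,
    Finset.mul_sum, Finset.mul_sum, ← Finset.sum_add_distrib, ← Finset.sum_add_distrib,
    ← Finset.sum_sub_distrib]
  refine Finset.sum_congr rfl fun i _ => ?_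
  linear_combination (c i * (q i - γ) * conj z ^ q i) * e (p i) z +
    (c i * (p i * (z * z ^ (p i - 1)) - γ * z ^ p i)) * e (q i) (conj z)

/-- The function `z ↦ F(-N, |m| - N, |m| + 1; |z|²) ξ_m(z)` is `(N, N)`-harmonic. -/
lemma harmonicOp_cellCoeff (N : ℕ) (m : ℤ) (k z : ℂ) :
    harmonicOp N N (fun z => ∑ i ∈ Finset.range (N + 1), k * cellCoeff N i m *
      (z ^ (m.toNat + i) * conj z ^ ((-m).toNat + i))) z = 0 := by
  rw [harmonicOp_sum_monomial]
  -- One of `m.toNat` and `(-m).toNat` is zero, so `(m.toNat + s)((-m).toNat + s) = s(|m| + s)`.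
  -- With `s = i` and `s = i - N`, the recurrence turns each summand into `E i - E (i + 1)`; both `E
  -- 0` and `E (N + 1)` vanish.
  let E : ℕ → ℂ := fun i => k * (i * (m.natAbs + i) * cellCoeff N i m) *
    (z ^ (m.toNat + i - 1) * conj z ^ ((-m).toNat + i - 1))
  have hm1 : (m.toNat : ℂ) * (-m).toNat = 0 := by
    rcases le_total 0 m with h | h
    · rw [show (-m).toNat = 0 by omega]; simp
    · rw [show m.toNat = 0 by omega]; simp
  have hm2 : (m.natAbs : ℂ) = m.toNat + (-m).toNat := by
    exact_mod_cast (by omega : m.natAbs = m.toNat + (-m).toNat)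
  have hE : ∀ i, k * cellCoeff N i m * (((m.toNat + i : ℕ) : ℂ) * ((-m).toNat + i : ℕ) *
      (z ^ (m.toNat + i - 1) * conj z ^ ((-m).toNat + i - 1)) -
      (((m.toNat + i : ℕ) : ℂ) - N) * (((-m).toNat + i : ℕ) - N) *
      (z ^ (m.toNat + i) * conj z ^ ((-m).toNat + i))) = E i - E (i + 1) := by
    intro i
    have h := cellCoeff_succ N i m
    simp only [E, ← add_assoc, Nat.add_sub_cancel]
    push_cast
    rw [hm2] at h ⊢
    linear_combination (k * cellCoeff N i m *
      ((z ^ (m.toNat + i - 1) * conj z ^ ((-m).toNat + i - 1)) -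
        (z ^ (m.toNat + i) * conj z ^ ((-m).toNat + i)))) * hm1 +
      k * (z ^ (m.toNat + i) * conj z ^ ((-m).toNat + i)) * h
  rw [Finset.sum_congr rfl fun i _ => hE i, Finset.sum_range_sub']
  simp [E, cellCoeff_eq_zero (Nat.lt_succ_self N)]

/-! ### Expansion of polyharmonic functions -/

open Polynomial in
/-- The function `u` has on the disc an expansion `∑ Q_m(|z|²) ξ_m(z)`. -/
def HasPolyExpansion (Q : subexponential[X]) (u : ℂ → ℂ) : Prop :=
  ∀ z ∈ unitDisc, HasSum (fun m => Q.eval₂ (subexponentialEval m) ((‖z‖ : ℂ) ^ 2) * xi m z) (u z)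

/-- Since `z^p z̄^k = |z|^(2 min(p, k)) ξ_{p-k}(z)`, frequency `m` comes only from `p = m + k`, and
carries the power `min(k, m + k) < n` of `|z|²`. -/
lemma exists_hasPolyExpansion_mul_conj_pow {n k : ℕ} (hk : k < n) {f : ℂ → ℂ}
    (hf : DifferentiableOn ℂ f unitDisc) :
    ∃ Q ∈ Polynomial.degreeLT subexponential n, HasPolyExpansion Q (fun z => f z * conj z ^ k) := by
  set a : ℕ → ℂ := fun p => (p.factorial : ℂ)⁻¹ * iteratedDeriv p f 0 with ha
  have hsum : ∀ z ∈ unitDisc, HasSum (fun p => a p * z ^ p) (f z) := fun z hz => by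
    refine (Complex.hasSum_taylorSeries_on_ball hf hz).congr_fun fun p => ?_
    simp only [ha, smul_eq_mul, sub_zero]
    ring
  set b : ℤ → ℂ := fun m => if 0 ≤ m + k then a (m + k).toNat else 0 with hb
  have hbS : b ∈ subexponential := by
    intro r h0 h1
    -- Convergence of the Taylor series at the real point `r` bounds `|a p| r^p`; the index shift by
    -- `k` costs only the constant `r^(-k)`.
    have hr : (r : ℂ) ∈ unitDisc := by
      rw [mem_unitDisc_iff, Complex.norm_real, Real.norm_of_nonneg h0.le]; exact h1
    obtain ⟨C, hC⟩ := (hsum r hr).summable.tendsto_atTop_zero.norm.bddAbove_range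
    have hC' : ∀ p, ‖a p‖ * r ^ p ≤ C := fun p => by
      have := hC ⟨p, rfl⟩
      simpa [abs_of_pos h0] using this
    have hC0 : 0 ≤ C := le_trans (by positivity) (hC' 0)
    refine ⟨C * (r ^ k)⁻¹, fun m => ?_⟩
    by_cases hm : 0 ≤ m + k
    · simp only [hb, if_pos hm]
      rw [le_mul_inv_iff₀ (by positivity), mul_assoc, ← pow_add]
      refine le_trans ?_ (hC' (m + k).toNat)
      gcongr ?_ * ?_
      exact pow_le_pow_of_le_one h0.le h1.le (by omega)
    · simp only [hb, if_neg hm, norm_zero, zero_mul]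
      positivity
  have hcS : ∀ l : ℕ, (fun m : ℤ => b m * if l = min k (m + k).toNat then 1 else 0) ∈
      subexponential := fun l => by
    refine subexponential.mul_mem hbS (mem_subexponential_of_bounded (C := 1) fun m => ?_)
    split_ifs <;> simp
  refine ⟨∑ l ∈ Finset.range n, Polynomial.C ⟨_, hcS l⟩ * Polynomial.X ^ l,
    sum_mem fun l hl => Polynomial.mem_degreeLT.mpr ((Polynomial.degree_C_mul_X_pow_le _ _).trans_lt
      (by exact_mod_cast Finset.mem_range.mp hl)), fun z hz => ?_⟩
  have hinj : Function.Injective fun p : ℕ => (p : ℤ) - k := fun p q h => by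
    simp only at h; omega
  have hterm : ∀ m : ℤ, (∑ l ∈ Finset.range n, Polynomial.C (⟨_, hcS l⟩ : subexponential) *
      Polynomial.X ^ l).eval₂ (subexponentialEval m) ((‖z‖ : ℂ) ^ 2) * xi m z =
      b m * (z ^ (m.toNat + min k (m + k).toNat) * conj z ^ ((-m).toNat + min k (m + k).toNat)) := by
    intro m
    rw [← norm_sq_pow_mul_xi, Polynomial.eval₂_finsetSum]
    simp only [Polynomial.eval₂_mul, Polynomial.eval₂_C, Polynomial.eval₂_X_pow,
      subexponentialEval_apply]
    rw [Finset.sum_eq_single (min k (m + k).toNat)]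
    · simp; ring
    · intro l _ hl
      simp [hl]
    · intro h
      exact absurd (Finset.mem_range.mpr (lt_of_le_of_lt (min_le_left _ _) hk)) h
  simp only [hterm]
  rw [← hinj.hasSum_iff]
  · refine ((hsum z hz).mul_right (conj z ^ k)).congr_fun fun p => ?_
    simp only [Function.comp_apply, hb]
    rw [if_pos (by omega), show ((p : ℤ) - k + k).toNat = p by omega,
      show ((p : ℤ) - k).toNat + min k p = p by omega,
      show (-((p : ℤ) - k)).toNat + min k p = k by omega]
    ring
  · intro m hm
    have : ¬ 0 ≤ m + k := fun h => hm ⟨(m + k).toNat, by simp only; omega⟩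
    simp [hb, this]

/-- Reflection of the index in subexponential sequences. -/
noncomputable def subexponentialReflect : subexponential →+* subexponential where
  toFun a := ⟨fun m => (a : ℤ → ℂ) (-m), fun r h0 h1 => by
    obtain ⟨C, hC⟩ := a.2 r h0 h1
    exact ⟨C, fun m => by simpa using hC (-m)⟩⟩
  map_one' := rfl
  map_mul' _ _ := rfl
  map_zero' := rfl
  map_add' _ _ := rfl

lemma xi_neg_conj (m : ℤ) (z : ℂ) : xi (-m) (conj z) = xi m z := by
  have h1 := norm_sq_pow_mul_xi 0 (-m) (conj z)
  have h2 := norm_sq_pow_mul_xi 0 m z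
  simp only [pow_zero, one_mul, add_zero, neg_neg, Complex.conj_conj] at h1 h2
  rw [h1, h2, mul_comm]

/-- Conjugation fixes `|z|` and exchanges `ξ_m` with `ξ_{-m}`. This reduces the terms `z^k G_k(z̄)`
to `G_k(z) z̄^k`. -/
lemma HasPolyExpansion.comp_conj {Q : Polynomial subexponential} {u : ℂ → ℂ}
    (h : HasPolyExpansion Q u) :
    HasPolyExpansion (Q.map subexponentialReflect) (fun z => u (conj z)) := by
  intro z hz
  rw [← (Equiv.neg ℤ).hasSum_iff]
  refine (h _ (conj_mem_unitDisc hz)).congr_fun fun m => ?_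
  simp only [Function.comp_apply, Equiv.neg_apply, Polynomial.eval₂_map]
  have : (subexponentialEval (-m)).comp subexponentialReflect = subexponentialEval m := by
    ext a
    change (a : ℤ → ℂ) (- -m) = (a : ℤ → ℂ) m
    rw [neg_neg]
  rw [this, ← xi_neg_conj (-m) z, neg_neg]
  simp

lemma HasPolyExpansion.add {P Q : Polynomial subexponential} {u v : ℂ → ℂ}
    (hu : HasPolyExpansion P u) (hv : HasPolyExpansion Q v) :
    HasPolyExpansion (P + Q) (fun z => u z + v z) := fun z hz => by
  simpa only [Polynomial.eval₂_add, add_mul] using (hu z hz).add (hv z hz)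

lemma HasPolyExpansion.sum {ι : Type*} (s : Finset ι) {Q : ι → Polynomial subexponential}
    {u : ι → ℂ → ℂ} (h : ∀ i ∈ s, HasPolyExpansion (Q i) (u i)) :
    HasPolyExpansion (∑ i ∈ s, Q i) (fun z => ∑ i ∈ s, u i z) := fun z hz => by
  simpa only [Polynomial.eval₂_finsetSum, Finset.sum_mul] using
    hasSum_sum fun i hi => h i hi z hz

theorem IsPolyharmonic.exists_hasPolyExpansion {n : ℕ} {u : ℂ → ℂ} (hu : IsPolyharmonic n u) :
    ∃ Q ∈ Polynomial.degreeLT subexponential n, HasPolyExpansion Q u := by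
  obtain ⟨G, f, hG, hf, huv⟩ := hu.exists_eq
  have h1 : ∀ k, ∃ Q, k < n → Q ∈ Polynomial.degreeLT subexponential n ∧
      HasPolyExpansion Q (fun z => G k z * conj z ^ k) := fun k => by
    by_cases hk : k < n
    · obtain ⟨Q, hQ, h⟩ := exists_hasPolyExpansion_mul_conj_pow hk (hG k)
      exact ⟨Q, fun _ => ⟨hQ, h⟩⟩
    · exact ⟨0, fun h => absurd h hk⟩
  have h2 : ∀ k, ∃ Q, k < n → Q ∈ Polynomial.degreeLT subexponential n ∧
      HasPolyExpansion Q (fun z => f k z * conj z ^ k) := fun k => by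
    by_cases hk : k < n
    · obtain ⟨Q, hQ, h⟩ := exists_hasPolyExpansion_mul_conj_pow hk (hf k)
      exact ⟨Q, fun _ => ⟨hQ, h⟩⟩
    · exact ⟨0, fun h => absurd h hk⟩
  choose P hP using h1
  choose Q hQ using h2
  refine ⟨∑ k ∈ Finset.range n, (P k).map subexponentialReflect + ∑ k ∈ Finset.range n, Q k,
    add_mem (sum_mem fun k hk => ?_) (sum_mem fun k hk => (hQ k (Finset.mem_range.mp hk)).1), ?_⟩
  · exact Polynomial.mem_degreeLT.mpr ((Polynomial.degree_map_le).trans_lt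
      (Polynomial.mem_degreeLT.mp (hP k (Finset.mem_range.mp hk)).1))
  · have h3 := (HasPolyExpansion.sum (Finset.range n) fun k hk =>
      (hP k (Finset.mem_range.mp hk)).2.comp_conj).add
      (HasPolyExpansion.sum (Finset.range n) fun k hk => (hQ k (Finset.mem_range.mp hk)).2)
    intro z hz
    have h4 := h3 z hz
    rw [huv z hz]
    simpa only [Complex.conj_conj, mul_comm (G _ _)] using h4

/-! ### The cellular decomposition -/

theorem mainTheorem3 (n : ℕ) (hn : 0 < n) (u : ℂ → ℂ) (hu : IsPolyharmonic n u) :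
    ∃ (k : ℤ → Fin n → ℂ) (w : Fin n → ℂ → ℂ),
      (∀ z ∈ unitDisc, u z = ∑ j : Fin n, (1 - (‖z‖ : ℂ) ^ 2) ^ (j : ℕ) * w j z) ∧
      ∀ j : Fin n,
        RootLimsupLeOne (fun m => k m j) ∧
        HasSmoothSum (fun m z => k m j * cellTerm n j m z) (w j) ∧
        IsGenHarmonic ((n : ℂ) - 1 - (j : ℕ)) ((n : ℂ) - 1 - (j : ℕ)) (w j) := by
  obtain ⟨Q, hQ, hQu⟩ := hu.exists_hasPolyExpansion
  obtain ⟨k, hk⟩ := Polynomial.exists_eq_sum_one_sub_X_pow_mul n (fun j => cellPoly (n - 1 - j))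
    (fun j _ => isUnit_eval_one_cellPoly _)
    (fun j hj => by have := natDegree_cellPoly_le (n - 1 - j); omega) Q
    (Polynomial.mem_degreeLT.mp hQ)
  have hterm : ∀ j : Fin n, (fun (m : ℤ) (z : ℂ) => (k j : ℤ → ℂ) m * cellTerm n j m z) =
      fun m z => ∑ i ∈ Finset.range (n - 1 - j + 1), (k j : ℤ → ℂ) m * cellCoeff (n - 1 - j) i m *
        (z ^ (m.toNat + i) * conj z ^ ((-m).toNat + i)) := by
    intro j
    ext m z
    rw [cellTerm_eq j.2, Finset.sum_mul, Finset.mul_sum]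
    refine Finset.sum_congr rfl fun i _ => ?_
    rw [← norm_sq_pow_mul_xi]
    ring
  have hsum : ∀ j : Fin n,
      SummableOnDiscs fun m z => (k j : ℤ → ℂ) m * cellTerm n j m z := fun j => by
    rw [hterm j]
    exact summableOnDiscs_of_mem_subexponential _
      (a := fun i m => (k j : ℤ → ℂ) m * cellCoeff (n - 1 - j) i m) fun i =>
      subexponential.mul_mem (k j).2 (cellCoeff_mem_subexponential _ _)
  refine ⟨fun m j => (k j : ℤ → ℂ) m, fun j z => ∑' m, (k j : ℤ → ℂ) m * cellTerm n j m z,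
    fun z hz => ?_, fun j => ⟨rootLimsupLeOne_of_mem_subexponential (k j).2,
      (hsum j).hasSmoothSum, (hsum j).isGenHarmonic fun m z _ => ?_⟩⟩
  -- Both sides are sums over `m` of the same terms, by the polynomial identity `hk` evaluated at
  -- index `m` and `X = |z|²`.
  · refine (hQu z hz).unique ?_
    refine (hasSum_sum fun j (_ : j ∈ Finset.univ) => ((hsum j).hasSum hz).mul_left
      ((1 - (‖z‖ : ℂ) ^ 2) ^ (j : ℕ))).congr_fun fun m => ?_
    rw [hk, Polynomial.eval₂_finsetSum, Finset.sum_mul, Finset.sum_range]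
    refine Finset.sum_congr rfl fun j _ => ?_
    rw [cellTerm_eq j.2, ← eval₂_cellPoly]
    simp only [Polynomial.eval₂_mul, Polynomial.eval₂_C, Polynomial.eval₂_pow,
      Polynomial.eval₂_sub, Polynomial.eval₂_one, Polynomial.eval₂_X, subexponentialEval_apply]
    ring
  · have hN : (n : ℂ) - 1 - (j : ℕ) = ((n - 1 - j : ℕ) : ℂ) := by
      rw [Nat.cast_sub (by omega), Nat.cast_sub (by omega), Nat.cast_one]
    rw [hN, congrFun (hterm j) m]
    exact harmonicOp_cellCoeff _ _ _ _
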